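/- Call integers $g_1,g_2,g_3$ a 3-term geometric progression if there is a rational number $r>1$ with $g_2=rg_1$ and $g_3=rg_2$. For every real $\varepsilon>0$ there exists an infinite sequence of positive integers $t_1<t_2<\cdots$, no three terms of which form a 3-term geometric progression, such that for every $n\ge 2$ $$t_n-t_{n-1}\le \exp\left(2\sqrt{\log 2\,\log t_n+\tfrac{3+\varepsilon}{2}\sqrt{\log 2\,\log t_n}\,\log\log t_n}\right),$$ where in particular the expression under the outer square root is nonnegative for every $n\ge 2$. -/

import Mathlib

/-- The integers `g 0, …, g (k - 1)` form a geometric progression of length `k` with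
rational ratio `r > 1`: each term is `r` times the previous one. -/
def IsGeometricProgression (k : ℕ) (r : ℚ) (g : Fin k → ℤ) : Prop :=
  1 < r ∧ ∀ i j : Fin k, (j : ℕ) = (i : ℕ) + 1 → (g j : ℚ) = r * (g i : ℚ)

/-- A set of integers avoids geometric progressions of length `k` (rational ratios allowed):
no `k` integers from the set are in geometric progression. -/
def AvoidsGeometricProgressions (k : ℕ) (S : Set ℤ) : Prop :=
  ¬ ∃ (r : ℚ) (g : Fin k → ℤ), IsGeometricProgression k r g ∧ ∀ i, g i ∈ S

/-- The expression
`log 2 · log x + ((3 + ε) / 2) · √(log 2 · log x) · log log x` under the outer square root. -/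
noncomputable def gapRadicand (ε x : ℝ) : ℝ :=
  Real.log 2 * Real.log x +
    (3 + ε) / 2 * Real.sqrt (Real.log 2 * Real.log x) * Real.log (Real.log x)

/-! ### Rough numbers, sieved numbers and their divisors. -/

namespace GeometricProgressionFree

open Finset

/-! The proof is an alteration argument. Select each sieved n ≥ 4^k₀ independently with probability
(9/32)^(level n), then delete every selected integer that is the middle term of a progression of
selected integers. What remains is progression-free. With positive probability it meets every cell
of length 4^s, s = ⌊√k⌋ + 1, into which each block [2^k, 2^(k+1)), k ≥ 2k₀, is cut. Gaps are then at
most 2·4^s ≤ 8 exp(2√(log 2 log t)), so the log log term only has to absorb the factor 8.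

Write a progression as a x², a x y, a y². If its middle term lies in a cell, the outer terms lie
outside (`outer_not_mem`), so which points are middle terms is independent of the selection inside
the cell. Sieving forces x and y to be rough, hence few: given b there are at most 2^s values of y,
and for each y fewer than 4s values of x (`IsThin`). So there are at most 4^s·2^s·4s candidates c,
of which very likely O(s(9/4)^s) are selected. Each c spoils at most 2^(3s/4) points of the cell.

The density q = 9/32 satisfies 8q·2^(3/4) < 4, so the spoiled points are few against 4^s, and 4q >
1, so some unspoiled point is very likely selected. A cell fails with probability at most
2·4^(-(k+1)), small enough for a union bound over at most 2^k cells per block. -/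

/-- `n` has no prime factor below `z`. -/
def IsRough (z n : ℕ) : Prop := ∀ p, p.Prime → p ∣ n → z ≤ p

/-- A slowly growing function: `level n` is about the square root of the binary logarithm of `n`. -/
def level (n : ℕ) : ℕ := Nat.sqrt (Nat.log 2 n) + 1

/-- `n` has no square divisor `d ^ 2` with `2 ≤ d < 2 ^ level n`. -/
def IsSieved (n : ℕ) : Prop := ∀ d, 2 ≤ d → d < 2 ^ level n → ¬ d ^ 2 ∣ n

/-- `b` is the middle term of a geometric progression whose outer terms lie in `A`. -/
def IsMiddle (A : Set ℕ) (b : ℕ) : Prop := ∃ m ∈ A, ∃ c ∈ A, m < b ∧ m * c = b ^ 2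

lemma level_mono : Monotone level := fun _ _ h =>
  Nat.add_le_add_right (Nat.sqrt_le_sqrt (Nat.log_mono_right h)) 1

lemma level_pos (n : ℕ) : 0 < level n := Nat.succ_pos _

lemma lt_two_pow_level_sq (n : ℕ) : n < 2 ^ (level n * level n) := by
  refine (Nat.lt_pow_succ_log_self one_lt_two n).trans_le (Nat.pow_le_pow_right two_pos ?_)
  exact Nat.lt_succ_sqrt (Nat.log 2 n)

lemma log_eq_of_mem {k n : ℕ} (h1 : 2 ^ k ≤ n) (h2 : n < 2 ^ (k + 1)) : Nat.log 2 n = k :=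
  (Nat.log_eq_iff (Or.inr ⟨one_lt_two, (lt_of_lt_of_le (by positivity) h1).ne'⟩)).2 ⟨h1, h2⟩

/-- A small prime factor p of x would give p² ∣ n, which the sieve forbids. -/
lemma IsSieved.isRough_of_sq_dvd {n x z : ℕ} (h : IsSieved n) (hx : x ^ 2 ∣ n) (hz : z ≤ n) :
    IsRough (2 ^ level z) x := by
  intro p hp hpx
  by_contra! hlt
  exact h p hp.two_le (hlt.trans_le (Nat.pow_le_pow_right two_pos (level_mono hz)))
    ((pow_dvd_pow_of_dvd hpx 2).trans hx)

/-- Parametrization of three-term geometric progressions of positive integers. -/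
lemma exists_param {m b c : ℕ} (hm : 0 < m) (hmb : m < b) (h : m * c = b ^ 2) :
    ∃ a x y, 0 < a ∧ 0 < x ∧ x < y ∧ m = a * x ^ 2 ∧ b = a * x * y ∧ c = a * y ^ 2 := by
  obtain ⟨g, x, y, hg, hxy, rfl, rfl⟩ := Nat.exists_coprime' (m := m) (n := b)
    (Nat.gcd_pos_of_pos_left _ hm)
  have hx : 0 < x := Nat.pos_of_mul_pos_right hm
  have h1 : x * c = g * y ^ 2 := by
    apply Nat.eq_of_mul_eq_mul_left hg
    linear_combination h
  have hd : x ∣ g := by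
    have : x ∣ g * y ^ 2 := ⟨c, h1.symm⟩
    exact (Nat.Coprime.pow_right 2 hxy).dvd_of_dvd_mul_right this
  obtain ⟨a, rfl⟩ := hd
  have ha : 0 < a := Nat.pos_of_mul_pos_left hg
  refine ⟨a, x, y, ha, hx, ?_, by ring, by ring, ?_⟩
  · exact lt_of_mul_lt_mul_right hmb (Nat.zero_le _)
  · apply Nat.eq_of_mul_eq_mul_left hx
    linear_combination h1

lemma IsRough.lcm {z : ℕ} {Y : Finset ℕ} (h : ∀ y ∈ Y, IsRough z y) : IsRough z (Y.lcm id) := by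
  intro p hp hpd
  have : Y.lcm id ∣ ∏ y ∈ Y, y := Finset.lcm_dvd fun y hy => Finset.dvd_prod_of_mem _ hy
  obtain ⟨y, hy, hpy⟩ := (Prime.dvd_finsetProd_iff hp.prime _).1 (hpd.trans this)
  exact h y hy p hp hpy

/-- Prime by prime: e + 1 ≤ 2^e and p ≥ 2^s give (e + 1)^s ≤ p^e. -/
lemma card_divisors_pow_le {s g : ℕ} (hg : g ≠ 0) (h : IsRough (2 ^ s) g) :
    g.divisors.card ^ s ≤ g := by
  rw [Nat.card_divisors hg, ← Finset.prod_pow]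
  conv_rhs => rw [← Nat.prod_factorization_pow_eq_self hg]
  refine Finset.prod_le_prod' fun p hp => ?_
  have hp' := Nat.mem_primeFactors.1 hp
  calc (g.factorization p + 1) ^ s ≤ (2 ^ g.factorization p) ^ s :=
        Nat.pow_le_pow_left (Nat.lt_two_pow_self) s
    _ = (2 ^ s) ^ g.factorization p := by rw [← pow_mul, ← pow_mul, mul_comm]
    _ ≤ p ^ g.factorization p := Nat.pow_le_pow_left (h p hp'.1 hp'.2.1) _

/-- The elements of `Y` all divide their least common multiple, which is again rough, so the divisor
bound applies to it. -/
lemma card_le_of_lcm_lt {s w : ℕ} {Y : Finset ℕ} (h : ∀ y ∈ Y, IsRough (2 ^ s) y)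
    (h0 : Y.lcm id ≠ 0) (hlt : Y.lcm id < 2 ^ (s * w)) : Y.card ≤ 2 ^ w := by
  have h1 : Y ⊆ (Y.lcm id).divisors := fun y hy =>
    Nat.mem_divisors.2 ⟨Finset.dvd_lcm (f := id) hy, h0⟩
  refine (Finset.card_le_card h1).trans (le_of_lt ?_)
  refine lt_of_pow_lt_pow_left' s ?_
  calc _ ≤ Y.lcm id := card_divisors_pow_le h0 (IsRough.lcm h)
    _ < 2 ^ (s * w) := hlt
    _ = _ := by rw [← pow_mul, mul_comm]

lemma card_rough_dvd_le {s w n : ℕ} (hn : n ≠ 0) (hlt : n < 2 ^ (s * w))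
    {Y : Finset ℕ} (h : ∀ y ∈ Y, IsRough (2 ^ s) y ∧ y ∣ n) : Y.card ≤ 2 ^ w := by
  have hd : Y.lcm id ∣ n := Finset.lcm_dvd fun y hy => (h y hy).2
  exact card_le_of_lcm_lt (fun y hy => (h y hy).1) (ne_zero_of_dvd_ne_zero hn hd)
    ((Nat.le_of_dvd (Nat.pos_of_ne_zero hn) hd).trans_lt hlt)

lemma lcm_sq_dvd {n : ℕ} {Y : Finset ℕ} (h : ∀ y ∈ Y, y ^ 2 ∣ n) : (Y.lcm id) ^ 2 ∣ n := by
  induction Y using Finset.induction_on with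
  | empty => simp
  | insert a Y _ ih =>
    rw [Finset.lcm_insert]
    have h1 := ih fun y hy => h y (Finset.mem_insert_of_mem hy)
    have h2 := h a (Finset.mem_insert_self _ _)
    have : (Nat.lcm a (Y.lcm id)) ^ 2 = Nat.lcm (a ^ 2) ((Y.lcm id) ^ 2) := by
      exact Nat.pow_lcm_pow.symm
    exact (this ▸ Nat.lcm_dvd h2 h1 : (Nat.lcm a (Y.lcm id)) ^ 2 ∣ n)

/-- The square of the least common multiple still divides n, which halves the exponent, up to
rounding. -/
lemma card_rough_sq_dvd_le {s n : ℕ} (hn : n ≠ 0) (hlt : n < 2 ^ (s * s))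
    {Y : Finset ℕ} (h : ∀ y ∈ Y, IsRough (2 ^ s) y ∧ y ^ 2 ∣ n) : Y.card ≤ 2 ^ ((s + 1) / 2) := by
  have hd : (Y.lcm id) ^ 2 ∣ n := lcm_sq_dvd fun y hy => (h y hy).2
  have h0 : Y.lcm id ≠ 0 := by
    intro h0
    rw [h0] at hd
    exact hn (by simpa using hd)
  refine card_le_of_lcm_lt (fun y hy => (h y hy).1) h0 ?_
  refine lt_of_pow_lt_pow_left' 2 ?_
  calc _ ≤ n := Nat.le_of_dvd (Nat.pos_of_ne_zero hn) hd
    _ < 2 ^ (s * s) := hlt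
    _ ≤ 2 ^ (s * ((s + 1) / 2) * 2) := by
      apply Nat.pow_le_pow_right two_pos
      rw [mul_assoc]
      exact Nat.mul_le_mul_left _ (by omega)
    _ = _ := by rw [← pow_mul]

/-! ### Sieved integers in short intervals. -/

lemma card_multiples_Ico_le {X h r : ℕ} (hr : 0 < r) :
    ((((Ico X (X + h)).filter (r ∣ ·)).card : ℕ) : ℝ) ≤ h / r + 1 := by
  have key : ((Ico X (X + h)).filter (r ∣ ·)).card ≤ h / r + 1 := by
    have : ((Ico X (X + h)).filter (r ∣ ·)).card ≤ (range (h / r + 1)).card := by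
      refine Finset.card_le_card_of_injOn (fun n => n / r - (X + r - 1) / r) ?_ ?_
      · intro n hn
        simp only [coe_filter, mem_Ico, Set.mem_ofPred_eq] at hn
        obtain ⟨⟨h1, h2⟩, q, rfl⟩ := hn
        simp only [coe_range, Set.mem_Iio, Nat.mul_div_cancel_left _ hr]
        rw [Nat.lt_succ_iff, Nat.le_div_iff_mul_le hr]
        have h3 : X ≤ r * ((X + r - 1) / r) := by
          have := Nat.lt_mul_div_succ (X + r - 1) hr
          rw [mul_add] at this
          omega
        rw [Nat.sub_mul, mul_comm q, mul_comm _ r]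
        omega
      · intro n hn n' hn' hnn
        simp only [coe_filter, mem_Ico, Set.mem_ofPred_eq] at hn hn'
        obtain ⟨⟨h1, h2⟩, q, rfl⟩ := hn
        obtain ⟨⟨h1', h2'⟩, q', rfl⟩ := hn'
        simp only [Nat.mul_div_cancel_left _ hr] at hnn
        have aux : ∀ t, X ≤ r * t → (X + r - 1) / r ≤ t := by
          intro t ht
          rw [← Nat.lt_succ_iff, Nat.div_lt_iff_lt_mul hr, Nat.succ_mul, mul_comm t]
          omega
        have := aux q h1
        have := aux q' h1'
        have : q = q' := by omega
        rw [this]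
    simpa using this
  calc _ ≤ (((h / r + 1 : ℕ)) : ℝ) := by exact_mod_cast key
    _ ≤ _ := by push_cast; gcongr; exact Nat.cast_div_le

lemma sum_inv_sq_le (N : ℕ) : ∑ d ∈ Ico 2 (N + 2), (1 : ℝ) / (d : ℝ) ^ 2 ≤ 3 / 4 := by
  -- The term d = 2 gives 1/4; the rest telescopes against 1/((d-1)d), with total 1/2.
  have : ∀ N : ℕ, ∑ d ∈ Ico 2 (N + 3), (1 : ℝ) / (d : ℝ) ^ 2 ≤ 3 / 4 - 1 / (N + 2) := by
    intro N
    induction N with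
    | zero => norm_num [Finset.sum_Ico_succ_top]
    | succ N ih =>
      rw [show N + 1 + 3 = (N + 3) + 1 from rfl, Finset.sum_Ico_succ_top (by omega)]
      have : (1 : ℝ) / ((N + 3 : ℕ) : ℝ) ^ 2 ≤ 1 / (N + 2) - 1 / ((N + 1 : ℕ) + 2) := by
        push_cast
        have : (1 : ℝ) / (N + 2) - 1 / (N + 1 + 2) = 1 / ((N + 2) * (N + 3)) := by
          field_simp; ring
        rw [this]
        gcongr
        nlinarith
      linarith
  cases N with
  | zero => norm_num
  | succ N => exact (this N).trans (by have : (0 : ℝ) ≤ 1 / (N + 2) := by positivity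
                                       linarith)

-- The sieve removes at most 3/4 of the interval plus a rounding error of 1 per d, below 2^s ≤ 4^s/8
-- in all.
open Classical in
lemma card_sieved_ge {X s : ℕ} (hs : 3 ≤ s) (hlev : ∀ n ∈ Ico X (X + 4 ^ s), level n = s) :
    (4 : ℝ) ^ s / 8 ≤ ((Ico X (X + 4 ^ s)).filter IsSieved).card := by
  set I := Ico X (X + 4 ^ s) with hI
  have hsub : I.filter (fun n => ¬ IsSieved n) ⊆
      (Ico 2 (2 ^ s)).biUnion fun d => I.filter (d ^ 2 ∣ ·) := by
    intro n hn
    obtain ⟨hn, hns⟩ := mem_filter.1 hn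
    simp only [IsSieved, not_forall, not_not] at hns
    obtain ⟨d, h2, hd, hdn⟩ := hns
    rw [hlev n hn] at hd
    exact mem_biUnion.2 ⟨d, mem_Ico.2 ⟨h2, hd⟩, mem_filter.2 ⟨hn, hdn⟩⟩
  have h1 : ((I.filter (fun n => ¬ IsSieved n)).card : ℝ) ≤ 4 ^ s * (3 / 4) + 2 ^ s := by
    calc ((I.filter (fun n => ¬ IsSieved n)).card : ℝ)
        ≤ ∑ d ∈ Ico (2 : ℕ) (2 ^ s), ((I.filter (d ^ 2 ∣ ·)).card : ℝ) := by
          exact_mod_cast (card_le_card hsub).trans card_biUnion_le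
      _ ≤ ∑ d ∈ Ico (2 : ℕ) (2 ^ s), ((4 : ℝ) ^ s * (1 / (d : ℝ) ^ 2) + 1) := by
          refine Finset.sum_le_sum fun d hd => ?_
          have := card_multiples_Ico_le (X := X) (h := 4 ^ s) (r := d ^ 2)
            (by have := (mem_Ico.1 hd).1; positivity)
          refine this.trans (le_of_eq ?_)
          push_cast
          ring
      _ ≤ _ := by
          rw [Finset.sum_add_distrib, ← Finset.mul_sum]
          have h2 := sum_inv_sq_le (2 ^ s - 2)
          have h3 : 2 ≤ 2 ^ s := by
            calc 2 = 2 ^ 1 := rfl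
              _ ≤ 2 ^ s := Nat.pow_le_pow_right two_pos (by omega)
          rw [Nat.sub_add_cancel h3] at h2
          have h4 : ∑ d ∈ Ico (2 : ℕ) (2 ^ s), (1 : ℝ) ≤ 2 ^ s := by
            rw [sum_const, Nat.card_Ico, nsmul_eq_mul, mul_one]
            exact_mod_cast Nat.sub_le _ _
          gcongr
  have h2 := Finset.card_filter_add_card_filter_not (s := I) IsSieved
  have h3 : I.card = 4 ^ s := by simp [hI]
  have h4 : ((I.filter IsSieved).card : ℝ) + (I.filter (fun n => ¬ IsSieved n)).card = 4 ^ s := by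
    rw [h3] at h2
    exact_mod_cast h2
  have h5 : (8 : ℝ) * 2 ^ s ≤ 4 ^ s := by
    have : (4 : ℝ) ^ s = 2 ^ s * 2 ^ s := by rw [← mul_pow]; norm_num
    rw [this]
    gcongr
    calc (8 : ℝ) = 2 ^ 3 := by norm_num
      _ ≤ 2 ^ s := pow_le_pow_right₀ (by norm_num) hs
  linarith

end GeometricProgressionFree

/-! ### Random sets with independent selections. -/

namespace GeometricProgressionFree

open Finset MeasureTheory
open scoped NNReal ENNReal

/-- The law of a coin that shows `true` with probability `p`. -/
noncomputable def coin (p : ℝ≥0) (hp : p ≤ 1) : PMF Bool :=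
  PMF.ofFintype (fun b => if b then p else 1 - p) (by simp [hp])

/-- The law of a random set containing each `n` independently with probability `p n`. -/
noncomputable def randomSet (p : ℕ → ℝ≥0) (hp : ∀ n, p n ≤ 1) : Measure (ℕ → Bool) :=
  Measure.infinitePi fun n => (coin (p n) (hp n)).toMeasure

/-- The part of the set coded by `ω` that lies in `s`. -/
def trace (s : Finset ℕ) (ω : ℕ → Bool) : Finset ℕ := s.filter (ω · = true)

section

variable {p : ℕ → ℝ≥0} {hp : ∀ n, p n ≤ 1}

instance : IsProbabilityMeasure (randomSet p hp) := by
  unfold randomSet; infer_instance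

lemma randomSet_box (s : Finset ℕ) (f : ℕ → Bool) :
    randomSet p hp {ω | ∀ n ∈ s, ω n = f n} = ∏ n ∈ s, (if f n then (p n : ℝ≥0∞) else 1 - p n) := by
  have : {ω : ℕ → Bool | ∀ n ∈ s, ω n = f n} = Set.pi s fun n => {f n} := by
    ext ω; simp [Set.mem_pi]
  rw [this, randomSet, Measure.infinitePi_pi _ (fun _ _ => MeasurableSet.singleton _)]
  refine Finset.prod_congr rfl fun n _ => ?_
  rw [PMF.toMeasure_apply_singleton _ _ (MeasurableSet.singleton _), coin, PMF.ofFintype_apply]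

lemma trace_eq_iff {s A : Finset ℕ} (hA : A ⊆ s) (ω : ℕ → Bool) :
    trace s ω = A ↔ ∀ n ∈ s, ω n = decide (n ∈ A) := by
  constructor
  · rintro rfl n hn
    simp [trace, hn]
  · intro h
    ext n
    simp only [trace, mem_filter]
    constructor
    · rintro ⟨hn, hω⟩
      simpa [h n hn] using hω
    · intro hn
      exact ⟨hA hn, by simp [h n (hA hn), hn]⟩

lemma trace_subset (s : Finset ℕ) (ω : ℕ → Bool) : trace s ω ⊆ s := filter_subset _ _

lemma randomSet_trace_eq_inter {s t A B : Finset ℕ} (hst : Disjoint s t) (hA : A ⊆ s)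
    (hB : B ⊆ t) :
    randomSet p hp {ω | trace s ω = A ∧ trace t ω = B} =
      randomSet p hp {ω | trace s ω = A} * randomSet p hp {ω | trace t ω = B} := by
  have h1 : {ω | trace s ω = A ∧ trace t ω = B} =
      {ω | ∀ n ∈ s ∪ t, ω n = decide (n ∈ A ∪ B)} := by
    ext ω
    simp only [Set.mem_ofPred_eq, trace_eq_iff hA, trace_eq_iff hB, mem_union, or_imp, forall_and]
    refine and_congr (forall₂_congr fun n hn => ?_) (forall₂_congr fun n hn => ?_)
    · have : n ∉ B := fun h => Finset.disjoint_left.1 hst hn (hB h)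
      simp [this]
    · have : n ∉ A := fun h => Finset.disjoint_left.1 hst (hA h) hn
      simp [this]
  rw [h1]
  simp only [trace_eq_iff hA, trace_eq_iff hB]
  rw [randomSet_box, randomSet_box, randomSet_box, Finset.prod_union hst]
  congr 1 <;> refine Finset.prod_congr rfl fun n hn => ?_
  · have : n ∉ B := fun h => Finset.disjoint_left.1 hst hn (hB h)
    simp [this]
  · have : n ∉ A := fun h => Finset.disjoint_left.1 hst (hA h) hn
    simp [this]

lemma measurableSet_trace_eq {s A : Finset ℕ} : MeasurableSet {ω | trace s ω = A} := by
  by_cases hA : A ⊆ s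
  · simp only [trace_eq_iff hA]
    have : {ω : ℕ → Bool | ∀ n ∈ s, ω n = decide (n ∈ A)} =
        Set.pi s fun n => {decide (n ∈ A)} := by
      ext ω; simp [Set.mem_pi]
    rw [this]
    exact MeasurableSet.pi s.countable_toSet fun _ _ => MeasurableSet.singleton _
  · convert MeasurableSet.empty
    ext ω
    simp only [Set.mem_ofPred_eq, Set.mem_empty_iff_false, iff_false]
    rintro rfl
    exact hA (trace_subset _ _)

open Classical in
lemma sum_randomSet_trace_eq (s : Finset ℕ) (Q : Finset ℕ → Prop) :
    ∑ A ∈ s.powerset.filter Q, randomSet p hp {ω | trace s ω = A} =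
      randomSet p hp {ω | Q (trace s ω)} := by
  rw [← measure_biUnion_finset]
  · congr 1
    ext ω
    simp only [mem_filter, mem_powerset, Set.mem_iUnion, Set.mem_ofPred_eq]
    constructor
    · rintro ⟨A, ⟨_, h⟩, rfl⟩
      exact h
    · intro h
      exact ⟨_, ⟨trace_subset _ _, h⟩, rfl⟩
  · intro A _ B _ hAB
    refine Set.disjoint_left.2 fun ω h1 h2 => hAB ?_
    exact h1.symm.trans h2
  · exact fun A _ => measurableSet_trace_eq

/-- If an event has probability at most `ε` conditionally on every value of the trace on `s`,
then it has probability at most `ε`. -/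
lemma randomSet_le_of_forall_trace {s t : Finset ℕ} (hst : Disjoint s t)
    (Q : Finset ℕ → Finset ℕ → Prop) {ε : ℝ≥0∞}
    (h : ∀ A ⊆ s, randomSet p hp {ω | Q A (trace t ω)} ≤ ε) :
    randomSet p hp {ω | Q (trace s ω) (trace t ω)} ≤ ε := by
  classical
  -- Both traces take finitely many values, so conditioning reduces to a finite double sum.
  have hsub : {ω | Q (trace s ω) (trace t ω)} ⊆ ⋃ A ∈ s.powerset, ⋃ B ∈ t.powerset.filter (Q A),
      {ω | trace s ω = A ∧ trace t ω = B} := by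
    intro ω hω
    simp only [Set.mem_iUnion, mem_filter, mem_powerset]
    exact ⟨_, trace_subset _ _, _, ⟨trace_subset _ _, hω⟩, rfl, rfl⟩
  refine (measure_mono hsub).trans ?_
  calc _ ≤ ∑ A ∈ s.powerset, ∑ B ∈ t.powerset.filter (Q A),
        randomSet p hp {ω | trace s ω = A ∧ trace t ω = B} :=
      (measure_biUnion_finset_le _ _).trans
        (Finset.sum_le_sum fun A _ => measure_biUnion_finset_le _ _)
    _ = ∑ A ∈ s.powerset, randomSet p hp {ω | trace s ω = A} *
        randomSet p hp {ω | Q A (trace t ω)} := by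
      refine Finset.sum_congr rfl fun A hA => ?_
      rw [← sum_randomSet_trace_eq, Finset.mul_sum]
      refine Finset.sum_congr rfl fun B hB => ?_
      exact randomSet_trace_eq_inter hst (mem_powerset.1 hA) (mem_powerset.1 (mem_filter.1 hB).1)
    _ ≤ ∑ A ∈ s.powerset, randomSet p hp {ω | trace s ω = A} * ε :=
      Finset.sum_le_sum fun A hA => mul_le_mul_right (h A (mem_powerset.1 hA)) _
    _ ≤ ε := by
      rw [← Finset.sum_mul]
      have := sum_randomSet_trace_eq (p := p) (hp := hp) s (fun _ => True)
      simp only [Finset.filter_true] at this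
      rw [this]
      simp

/-- The probability that many elements of a given finite set are selected. -/
lemma randomSet_card_le {s : Finset ℕ} {q : ℝ≥0} (hq : ∀ n ∈ s, p n ≤ q) (J : ℕ) :
    randomSet p hp {ω | J ≤ (trace s ω).card} ≤ ((s.card.choose J : ℕ) : ℝ≥0∞) * (q : ℝ≥0∞) ^ J := by
  have hsub : {ω | J ≤ (trace s ω).card} ⊆
      ⋃ B ∈ s.powersetCard J, {ω | ∀ n ∈ B, ω n = true} := by
    intro ω hω
    obtain ⟨B, hB, hBJ⟩ := Finset.exists_subset_card_eq (Set.mem_ofPred_eq ▸ hω)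
    simp only [Set.mem_iUnion, mem_powersetCard]
    exact ⟨B, ⟨hB.trans (trace_subset _ _), hBJ⟩, fun n hn => (mem_filter.1 (hB hn)).2⟩
  refine (measure_mono hsub).trans ((measure_biUnion_finset_le _ _).trans ?_)
  rw [← Finset.card_powersetCard, ← nsmul_eq_mul]
  refine Finset.sum_le_card_nsmul _ _ _ fun B hB => ?_
  obtain ⟨hBs, hBJ⟩ := mem_powersetCard.1 hB
  rw [randomSet_box B fun _ => true]
  simp only [if_true]
  calc ∏ n ∈ B, (p n : ℝ≥0∞) ≤ ∏ n ∈ B, (q : ℝ≥0∞) :=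
        Finset.prod_le_prod' fun n hn => by exact_mod_cast hq n (hBs hn)
    _ = _ := by rw [Finset.prod_const, hBJ]

/-- The probability that no element of a given finite set is selected. -/
lemma randomSet_disjoint {s G : Finset ℕ} (hG : G ⊆ s) {q : ℝ≥0} (hq : ∀ n ∈ G, p n = q) :
    randomSet p hp {ω | Disjoint (trace s ω) G} = (1 - (q : ℝ≥0∞)) ^ G.card := by
  have : {ω | Disjoint (trace s ω) G} = {ω | ∀ n ∈ G, ω n = false} := by
    ext ω
    simp only [Set.mem_ofPred_eq, Finset.disjoint_right, trace, mem_filter, not_and,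
      Bool.not_eq_true]
    exact forall₂_congr fun n hn => ⟨fun h => h (hG hn), fun h _ => h⟩
  rw [this, randomSet_box G fun _ => false]
  rw [Finset.prod_congr rfl (g := fun _ => 1 - (q : ℝ≥0∞)) fun n hn => by simp [hq n hn],
    Finset.prod_const]

end

end GeometricProgressionFree

/-! ### Deterministic counts for progressions centred in a short interval. -/

namespace GeometricProgressionFree

open Finset

/-- The sieved integers from `4 ^ k₀` on. -/
def IsAdmissible (k₀ n : ℕ) : Prop := 4 ^ k₀ ≤ n ∧ IsSieved n

open Classical in
/-- The rough divisors `x` of `d` for which `d * x` lies in `A`. -/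
noncomputable def roughShifts (A : Set ℕ) (d : ℕ) : Finset ℕ :=
  d.divisors.filter fun x => IsRough (2 ^ level d) x ∧ d * x ∈ A

/-- `A` contains few multiples `d * x` of each `d` by a rough divisor `x` of `d`. -/
def IsThin (A : Set ℕ) : Prop := ∀ d, (roughShifts A d).card < 4 * level d

lemma mem_roughShifts {A : Set ℕ} {d x : ℕ} :
    x ∈ roughShifts A d ↔ x ∈ d.divisors ∧ IsRough (2 ^ level d) x ∧ d * x ∈ A := by
  simp only [roughShifts, mem_filter]

lemma roughShifts_mono {A B : Set ℕ} (h : A ⊆ B) (d : ℕ) : roughShifts A d ⊆ roughShifts B d := by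
  intro x
  simp only [mem_roughShifts]
  exact fun ⟨h1, h2, h3⟩ => ⟨h1, h2, h h3⟩

open Classical in
/-- The admissible integers in `s`. -/
noncomputable def admissible (k₀ : ℕ) (s : Finset ℕ) : Finset ℕ := s.filter (IsAdmissible k₀)

open Classical in
/-- The elements of `S` that complete some `m ∈ A` to a progression with middle term in `I`. -/
noncomputable def completions (A S I : Finset ℕ) : Finset ℕ :=
  S.filter fun c => ∃ b ∈ I, ∃ m ∈ A, m * c = b ^ 2

lemma eq_of_dvd_of_mem_Ico {X h e b b' : ℕ} (he : h ≤ e) (hb : b ∈ Ico X (X + h))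
    (hb' : b' ∈ Ico X (X + h)) (hd : e ∣ b) (hd' : e ∣ b') : b = b' := by
  wlog hle : b ≤ b' generalizing b b'
  · exact (this hb' hb hd' hd (by omega)).symm
  rw [mem_Ico] at hb hb'
  have := Nat.eq_zero_of_dvd_of_lt (Nat.dvd_sub hd' hd) (by omega)
  omega

/-- `[X, X + 4 ^ s)` is a short interval inside `[2 ^ k, 2 ^ (k + 1))`. -/
structure IsShortInterval (k s X : ℕ) : Prop where
  level_eq : s = Nat.sqrt k + 1
  four_mul_le : 4 * s ≤ k
  lower : 2 ^ k ≤ X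
  upper : X + 4 ^ s ≤ 2 ^ (k + 1)

namespace IsShortInterval

variable {k s X : ℕ} (h : IsShortInterval k s X)
include h

lemma level_of_mem {b : ℕ} (hb : b ∈ Ico X (X + 4 ^ s)) : level b = s := by
  rw [mem_Ico] at hb
  rw [level, log_eq_of_mem (h.lower.trans hb.1) (hb.2.trans_le h.upper), h.level_eq]

/-- The field `four_mul_le` makes the interval no longer than √X, while the differences inside a
progression are at least such an e. -/
lemma four_pow_le {b e : ℕ} (hb : X ≤ b) (hbe : b ≤ e ^ 2) : 4 ^ s ≤ e := by
  have h1 : (4 ^ s) ^ 2 ≤ e ^ 2 := by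
    calc (4 ^ s) ^ 2 = 2 ^ (4 * s) := by
          rw [show 4 = 2 ^ 2 by norm_num, ← pow_mul, ← pow_mul]; congr 1; ring
      _ ≤ 2 ^ k := Nat.pow_le_pow_right two_pos h.four_mul_le
      _ ≤ e ^ 2 := h.lower.trans (hb.trans hbe)
  exact (Nat.pow_le_pow_iff_left two_ne_zero).1 h1

lemma pos : 0 < X := lt_of_lt_of_le (by positivity) h.lower

/-- The outer terms of a progression with middle term in a short interval lie outside it. -/
lemma outer_not_mem {m b c : ℕ} (hb : b ∈ Ico X (X + 4 ^ s)) (hm : 0 < m) (hmb : m < b)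
    (hmc : m * c = b ^ 2) : m < X ∧ X + 4 ^ s ≤ c ∧ c < 4 ^ (k + 1) := by
  obtain ⟨a, x, y, ha, hx, hxy, h1, h2, h3⟩ := exists_param hm hmb hmc
  rw [mem_Ico] at hb
  refine ⟨?_, ?_, ?_⟩
  · by_contra! hc
    -- Here m = a x² ≤ (a x)², and b - m = a x (y - x) ≥ a x.
    have h4 : 4 ^ s ≤ a * x := h.four_pow_le hc (by rw [h1]; nlinarith [Nat.zero_le (x ^ 2)])
    have h5 : m + a * x ≤ b := by
      rw [h1, h2]; nlinarith [Nat.mul_le_mul_left (a * x) hxy]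
    omega
  · have h4 : 4 ^ s ≤ a * y := by
      refine h.four_pow_le hb.1 ?_
      rw [h2]
      have : a * x * y ≤ a * y * y := by gcongr
      nlinarith [Nat.zero_le (y ^ 2), Nat.mul_le_mul_right (a * y ^ 2) ha]
    have h5 : b + a * y ≤ c := by
      rw [h3, h2]; nlinarith [Nat.mul_le_mul_left (a * y) hxy]
    omega
  · have : b < 2 ^ (k + 1) := hb.2.trans_le h.upper
    calc c ≤ m * c := Nat.le_mul_of_pos_left _ hm
      _ = b ^ 2 := hmc
      _ < (2 ^ (k + 1)) ^ 2 := Nat.pow_lt_pow_left this two_ne_zero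
      _ = 4 ^ (k + 1) := by rw [← pow_mul, mul_comm, pow_mul]; norm_num

/-- A completion c = (b/x)·y is determined by b, a rough divisor y of b, and x. As m = (b/y)·x lies
in `A`, thinness at d = b/y bounds the choices of x. -/
lemma card_completions_le {k₀ : ℕ} {A S : Finset ℕ} (hA : A ⊆ admissible k₀ (range X))
    (hthin : IsThin A) (hS : S ⊆ admissible k₀ (Ico (X + 4 ^ s) (4 ^ (k + 1)))) :
    (completions A S (Ico X (X + 4 ^ s))).card ≤ 4 ^ s * (2 ^ s * (4 * s)) := by
  classical
  have hsub : completions A S (Ico X (X + 4 ^ s)) ⊆ (Ico X (X + 4 ^ s)).biUnion fun b =>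
      (b.divisors.filter (IsRough (2 ^ s))).biUnion fun y =>
        (roughShifts A (b / y)).image fun x => b / x * y := by
    intro c hc
    obtain ⟨hcS, b, hb, m, hm, hmc⟩ := mem_filter.1 hc
    have hm' := mem_filter.1 (hA hm)
    have hc' := mem_filter.1 (hS hcS)
    have hmX := mem_range.1 hm'.1
    have hb' := mem_Ico.1 hb
    have hcX := mem_Ico.1 hc'.1
    have hm0 : 0 < m := lt_of_lt_of_le (by positivity) hm'.2.1
    obtain ⟨a, x, y, ha, hx, hxy, h1, h2, h3⟩ := exists_param hm0 (by omega) hmc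
    have hy : 0 < y := hx.trans hxy
    have hbx : b / x * y = c := by
      rw [h2, show a * x * y = a * y * x by ring, Nat.mul_div_cancel _ hx, h3]; ring
    have hby : b / y = a * x := by rw [h2, Nat.mul_div_cancel _ hy]
    have hb0 : b ≠ 0 := by rw [h2]; positivity
    simp only [mem_biUnion, mem_image]
    refine ⟨b, hb, y, ?_, x, ?_, hbx⟩
    · refine mem_filter.2 ⟨Nat.mem_divisors.2 ⟨⟨a * x, by rw [h2]; ring⟩, hb0⟩, ?_⟩
      rw [← h.level_of_mem hb]
      exact hc'.2.2.isRough_of_sq_dvd ⟨a, by rw [h3]; ring⟩ (by omega)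
    · rw [hby, mem_roughShifts]
      refine ⟨Nat.mem_divisors.2 ⟨Dvd.intro_left a rfl, by positivity⟩, ?_, ?_⟩
      · refine hm'.2.2.isRough_of_sq_dvd ⟨a, by rw [h1]; ring⟩ ?_
        rw [h1]
        nlinarith [Nat.mul_le_mul_left (a * x) hx]
      · rw [show a * x * x = m by rw [h1]; ring]
        exact hm
  refine (card_le_card hsub).trans ?_
  have hI : (Ico X (X + 4 ^ s)).card = 4 ^ s := by simp
  nth_rw 2 [← hI]
  refine card_biUnion_le_card_mul _ _ _ fun b hb => ?_
  have hb' := mem_Ico.1 hb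
  have hlev := h.level_of_mem hb
  have hb0 : b ≠ 0 := by have := h.pos; omega
  have h1 : (b.divisors.filter (IsRough (2 ^ s))).card ≤ 2 ^ s := by
    refine card_rough_dvd_le (s := s) hb0 ?_ fun y hy =>
      ⟨(mem_filter.1 hy).2, Nat.dvd_of_mem_divisors (mem_filter.1 hy).1⟩
    have := lt_two_pow_level_sq b
    rwa [hlev] at this
  refine (card_biUnion_le_card_mul _ _ (4 * s) fun y hy => ?_).trans (Nat.mul_le_mul_right _ h1)
  refine card_image_le.trans ((hthin _).le.trans ?_)
  rw [← hlev]
  exact Nat.mul_le_mul_left _ (level_mono (Nat.div_le_self _ _))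

/-- Since c < 4^(k+1), its level is at most √2·s + 1. The bound needs s ≥ 4/(3 - 2√2) ≈ 23.3, hence
24. -/
lemma half_level_le (hs : 24 ≤ s) {c : ℕ} (hc : c < 4 ^ (k + 1)) :
    (level c + 1) / 2 ≤ 3 * s / 4 := by
  have h1 : Nat.log 2 c < 2 * (k + 1) := by
    by_cases hc0 : c = 0
    · simp [hc0]
    · refine (Nat.log_lt_iff_lt_pow one_lt_two hc0).2 ?_
      rwa [pow_mul]
  have h2 : k + 1 ≤ s * s := by
    have := Nat.lt_succ_sqrt k
    rw [h.level_eq]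
    exact this
  have h3 := Nat.sqrt_le (Nat.log 2 c)
  set r := Nat.sqrt (Nat.log 2 c) with hr
  have hl : level c = r + 1 := rfl
  rw [hl]
  have h4 : 2 * r + 4 ≤ 3 * s := by
    by_contra! hlt
    have h5 : r * r < 2 * (s * s) := by omega
    nlinarith
  omega

-- Given c, the middle term is a multiple of c/y = a y ≥ 4^s, so y determines it within the
-- interval; and y is rough with y² ∣ c.
open Classical in
lemma card_middle_of_completion_le {k₀ : ℕ} (hs : 24 ≤ s) {A : Finset ℕ} {c : ℕ}
    (hA : A ⊆ admissible k₀ (range X))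
    (hc : c ∈ admissible k₀ (Ico (X + 4 ^ s) (4 ^ (k + 1)))) :
    ((Ico X (X + 4 ^ s)).filter fun b => ∃ m ∈ A, m * c = b ^ 2).card ≤ 2 ^ (3 * s / 4) := by
  have hc' := mem_filter.1 hc
  have hcX := mem_Ico.1 hc'.1
  have hc0 : c ≠ 0 := (h.pos.trans_le ((Nat.le_add_right _ _).trans hcX.1)).ne'
  set Y := c.divisors.filter fun y => IsRough (2 ^ level c) y ∧ y ^ 2 ∣ c with hY
  have hYcard : Y.card ≤ 2 ^ (3 * s / 4) :=
    (card_rough_sq_dvd_le (s := level c) hc0 (lt_two_pow_level_sq c)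
      fun y hy => (mem_filter.1 hy).2).trans
      (Nat.pow_le_pow_right two_pos (h.half_level_le hs hcX.2))
  refine le_trans ?_ hYcard
  have key : ∀ b ∈ (Ico X (X + 4 ^ s)).filter (fun b => ∃ m ∈ A, m * c = b ^ 2),
      ∃ y ∈ Y, ∃ e, c = e * y ∧ e ∣ b ∧ 4 ^ s ≤ e := by
    intro b hb
    obtain ⟨hb, m, hm, hmc⟩ := mem_filter.1 hb
    have hm' := mem_filter.1 (hA hm)
    have hmX := mem_range.1 hm'.1
    have hb' := mem_Ico.1 hb
    have hm0 : 0 < m := lt_of_lt_of_le (by positivity) hm'.2.1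
    obtain ⟨a, x, y, ha, hx, hxy, h1, h2, h3⟩ := exists_param hm0 (by omega) hmc
    have hyc : y ^ 2 ∣ c := ⟨a, by rw [h3]; ring⟩
    refine ⟨y, mem_filter.2 ⟨Nat.mem_divisors.2 ⟨⟨a * y, by rw [h3]; ring⟩, hc0⟩,
      hc'.2.2.isRough_of_sq_dvd hyc le_rfl, hyc⟩, a * y, by rw [h3]; ring,
      ⟨x, by rw [h2]; ring⟩, ?_⟩
    refine h.four_pow_le (b := c) (by omega) ?_
    rw [h3]
    nlinarith [Nat.zero_le (y ^ 2), Nat.mul_le_mul_right (a * y ^ 2) ha]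
  choose! f hfY e hce heb hse using key
  refine card_le_card_of_injOn f hfY fun b hb b' hb' hff => ?_
  have h1 := hce b hb
  have h2 := hce b' hb'
  rw [hff] at h1
  have hf0 : 0 < f b' := Nat.pos_of_ne_zero fun h0 => hc0 (by rw [h2, h0, mul_zero])
  have hee : e b = e b' := Nat.eq_of_mul_eq_mul_right hf0 (h1.symm.trans h2)
  exact eq_of_dvd_of_mem_Ico (hse b hb) (mem_filter.1 hb).1 (mem_filter.1 hb').1 (heb b hb)
    (hee ▸ heb b' hb')

open Classical in
lemma card_middle_le {k₀ : ℕ} (hs : 24 ≤ s) {A C : Finset ℕ}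
    (hA : A ⊆ admissible k₀ (range X))
    (hC : C ⊆ admissible k₀ (Ico (X + 4 ^ s) (4 ^ (k + 1)))) :
    ((Ico X (X + 4 ^ s)).filter (IsMiddle (A ∪ C : Finset ℕ))).card ≤
      (completions A C (Ico X (X + 4 ^ s))).card * 2 ^ (3 * s / 4) := by
  have hsub : (Ico X (X + 4 ^ s)).filter (IsMiddle (A ∪ C : Finset ℕ)) ⊆
      (completions A C (Ico X (X + 4 ^ s))).biUnion fun c =>
        (Ico X (X + 4 ^ s)).filter fun b => ∃ m ∈ A, m * c = b ^ 2 := by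
    intro b hb
    obtain ⟨hb, m, hm, c, hc, hmb, hmc⟩ := mem_filter.1 hb
    have hpos : ∀ n ∈ A ∪ C, 0 < n := by
      intro n hn
      rcases mem_union.1 hn with hn | hn
      · exact lt_of_lt_of_le (by positivity) (mem_filter.1 (hA hn)).2.1
      · exact lt_of_lt_of_le (by positivity) (mem_filter.1 (hC hn)).2.1
    obtain ⟨h1, h2, h3⟩ := h.outer_not_mem hb (hpos m hm) hmb hmc
    have hmA : m ∈ A := by
      rcases mem_union.1 hm with hm | hm
      · exact hm
      · have := (mem_Ico.1 (mem_filter.1 (hC hm)).1).1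
        have : 0 < 4 ^ s := by positivity
        omega
    have hcC : c ∈ C := by
      rcases mem_union.1 hc with hc | hc
      · have := mem_range.1 (mem_filter.1 (hA hc)).1
        have : 0 < 4 ^ s := by positivity
        omega
      · exact hc
    refine mem_biUnion.2 ⟨c, mem_filter.2 ⟨hcC, b, hb, m, hmA, hmc⟩, mem_filter.2 ⟨hb, m, hmA, hmc⟩⟩
  exact (card_le_card hsub).trans (card_biUnion_le_card_mul _ _ _ fun c hc =>
    h.card_middle_of_completion_le hs hA (hC (mem_filter.1 hc).1))

end IsShortInterval

end GeometricProgressionFree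

/-! ### Probability estimates for one interval. -/

namespace GeometricProgressionFree

open Finset MeasureTheory Filter
open scoped NNReal ENNReal

/-- The probability with which `n` is selected. -/
noncomputable def density (n : ℕ) : ℝ≥0 := (9 / 32) ^ level n

lemma density_le_one (n : ℕ) : density n ≤ 1 := pow_le_one₀ (by positivity) (by
  rw [← NNReal.coe_le_coe]; push_cast; norm_num)

lemma density_le {n s : ℕ} (h : s ≤ level n) : density n ≤ (9 / 32) ^ s :=
  pow_le_pow_of_le_one (by positivity) (by rw [← NNReal.coe_le_coe]; push_cast; norm_num) h

/-- The law of the random selection. -/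
noncomputable def selectionLaw : Measure (ℕ → Bool) := randomSet density density_le_one

instance : IsProbabilityMeasure selectionLaw := by unfold selectionLaw; infer_instance

/-- The admissible integers selected by `ω`. -/
def selected (k₀ : ℕ) (ω : ℕ → Bool) : Set ℕ := {n | IsAdmissible k₀ n ∧ ω n = true}

/-- There are at most 2^s candidate shifts, each selected with probability at most (9/32)^s, and
(2·9/32)^4 ≤ 1/8. -/
lemma selectionLaw_many_shifts_le {d : ℕ} (hd : d ≠ 0) :
    selectionLaw {ω | 4 * level d ≤ (roughShifts {n | ω n = true} d).card} ≤
      (((1 / 8) ^ (level d * level d) : ℝ≥0) : ℝ≥0∞) := by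
  classical
  set s := level d with hs
  set D := d.divisors.filter (IsRough (2 ^ s)) with hD
  set S := D.image (d * ·) with hS
  have hinj : Function.Injective (d * ·) := fun a b h =>
    Nat.eq_of_mul_eq_mul_left (Nat.pos_of_ne_zero hd) h
  have hcard : S.card ≤ 2 ^ s := by
    refine card_image_le.trans (card_rough_dvd_le (s := s) hd (lt_two_pow_level_sq d) fun y hy =>
      ⟨(mem_filter.1 hy).2, Nat.dvd_of_mem_divisors (mem_filter.1 hy).1⟩)
  have hsub : {ω | 4 * s ≤ (roughShifts {n | ω n = true} d).card} ⊆
      {ω | 4 * s ≤ (trace S ω).card} := by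
    intro ω hω
    refine le_trans (Set.mem_ofPred_eq ▸ hω) ?_
    rw [← card_image_of_injective _ hinj]
    refine card_le_card fun n hn => ?_
    obtain ⟨x, hx, rfl⟩ := mem_image.1 hn
    obtain ⟨h1, h2, h3⟩ := mem_roughShifts.1 hx
    exact mem_filter.2 ⟨mem_image_of_mem _ (mem_filter.2 ⟨h1, h2⟩), h3⟩
  refine (measure_mono hsub).trans ((randomSet_card_le (q := (9 / 32) ^ s) ?_ _).trans ?_)
  · intro n hn
    obtain ⟨x, hx, rfl⟩ := mem_image.1 hn
    refine density_le (level_mono (Nat.le_mul_of_pos_right _ ?_))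
    exact Nat.pos_of_mem_divisors (mem_filter.1 hx).1
  · have : ((S.card.choose (4 * s) : ℕ) : ℝ≥0) * ((9 / 32) ^ s) ^ (4 * s) ≤ (1 / 8) ^ (s * s) := by
      calc ((S.card.choose (4 * s) : ℕ) : ℝ≥0) * ((9 / 32) ^ s) ^ (4 * s)
          ≤ (2 ^ s) ^ (4 * s) * ((9 / 32) ^ s) ^ (4 * s) := by
            gcongr
            exact_mod_cast (Nat.choose_le_pow _ _).trans (Nat.pow_le_pow_left hcard _)
        _ = ((2 * (9 / 32)) ^ 4) ^ (s * s) := by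
            rw [← mul_pow, ← mul_pow, ← pow_mul, ← pow_mul]
            congr 1
            ring
        _ ≤ (1 / 8) ^ (s * s) := by
            gcongr
            rw [← NNReal.coe_le_coe]
            push_cast
            norm_num
    exact_mod_cast this

lemma selectionLaw_block_shifts_le (l : ℕ) :
    selectionLaw {ω : ℕ → Bool | ∃ d ∈ Ico (2 ^ l) (2 ^ (l + 1)),
      4 * level d ≤ (roughShifts {n | ω n = true} d).card} ≤
      (((1 / 4) ^ (l + 1) : ℝ≥0) : ℝ≥0∞) := by
  have hsub : {ω : ℕ → Bool | ∃ d ∈ Ico (2 ^ l) (2 ^ (l + 1)),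
      4 * level d ≤ (roughShifts {n | ω n = true} d).card} ⊆ ⋃ d ∈ Ico (2 ^ l) (2 ^ (l + 1)),
      {ω | 4 * level d ≤ (roughShifts {n | ω n = true} d).card} := by
    rintro ω ⟨d, hd, h⟩
    simp only [Set.mem_iUnion]
    exact ⟨d, hd, h⟩
  refine (measure_mono hsub).trans ((measure_biUnion_finset_le _ _).trans ?_)
  calc _ ≤ ∑ d ∈ Ico (2 ^ l) (2 ^ (l + 1)), (((1 / 8) ^ (l + 1) : ℝ≥0) : ℝ≥0∞) := by
        refine Finset.sum_le_sum fun d hd => ?_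
        rw [mem_Ico] at hd
        have hd0 : d ≠ 0 := (lt_of_lt_of_le (by positivity) hd.1).ne'
        refine (selectionLaw_many_shifts_le hd0).trans ?_
        have : l + 1 ≤ level d * level d := by
          rw [level, log_eq_of_mem hd.1 hd.2]
          exact Nat.lt_succ_sqrt l
        rw [ENNReal.coe_le_coe]
        refine pow_le_pow_of_le_one (by positivity) ?_ this
        rw [← NNReal.coe_le_coe]; push_cast; norm_num
    _ ≤ _ := by
        rw [sum_const, Nat.card_Ico, nsmul_eq_mul]
        have h1 : 2 ^ (l + 1) - 2 ^ l = 2 ^ l := by rw [pow_succ]; omega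
        rw [h1]
        have : ((2 ^ l : ℕ) : ℝ≥0) * (1 / 8) ^ (l + 1) ≤ (1 / 4) ^ (l + 1) := by
          calc ((2 ^ l : ℕ) : ℝ≥0) * (1 / 8) ^ (l + 1) ≤ 2 ^ (l + 1) * (1 / 8) ^ (l + 1) := by
                push_cast
                gcongr
                · rw [← NNReal.coe_le_coe]; push_cast; norm_num
                · omega
            _ = (1 / 4) ^ (l + 1) := by
                rw [← mul_pow]
                congr 1
                rw [← NNReal.coe_inj]; push_cast; norm_num
        exact_mod_cast this

/-- A Chernoff-type bound: J! ≥ (J/e)^J and e < 4, for a threshold J at least eight times the mean.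
-/
lemma choose_mul_pow_le {N J : ℕ} {q : ℝ≥0} (h : (N : ℝ) * q ≤ J / 8) :
    ((N.choose J : ℕ) : ℝ≥0) * q ^ J ≤ (1 / 2) ^ J := by
  rw [← NNReal.coe_le_coe]
  push_cast
  have hf : (0 : ℝ) < (J.factorial : ℝ) := by positivity
  calc ((N.choose J : ℕ) : ℝ) * (q : ℝ) ^ J ≤ (N : ℝ) ^ J / J.factorial * (q : ℝ) ^ J := by
        gcongr
        exact Nat.choose_le_pow_div J N
    _ = ((N : ℝ) * q) ^ J / J.factorial := by rw [mul_pow]; ring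
    _ ≤ ((J : ℝ) / 8) ^ J / J.factorial := by gcongr
    _ = (J : ℝ) ^ J / J.factorial * (1 / 8) ^ J := by rw [div_pow, div_pow]; ring
    _ ≤ Real.exp J * (1 / 8) ^ J := by
        gcongr
        exact Real.pow_div_factorial_le_exp _ (by positivity) _
    _ ≤ 4 ^ J * (1 / 8) ^ J := by
        gcongr
        rw [← mul_one (J : ℝ), Real.exp_nat_mul]
        gcongr
        linarith [Real.exp_one_lt_d9]
    _ = (1 / 2) ^ J := by rw [← mul_pow]; norm_num

/-- Numerical inequalities that hold for all sufficiently large `s`. -/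
structure IsLarge (s : ℕ) : Prop where
  ge : 24 ≤ s
  killed : (32 * s * (9 / 4) ^ s + 1) * (17 / 10) ^ s ≤ (4 : ℝ) ^ s / 16
  growth : (2 * s ^ 2 : ℝ) ≤ (9 / 8) ^ s / 16

lemma eventually_isLarge : ∀ᶠ s in atTop, IsLarge s := by
  have h1 : Tendsto (fun s : ℕ => (s : ℝ) * (153 / 160) ^ s) atTop (nhds 0) :=
    tendsto_self_mul_const_pow_of_lt_one (by norm_num) (by norm_num)
  have h2 : Tendsto (fun s : ℕ => ((17 : ℝ) / 40) ^ s) atTop (nhds 0) :=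
    tendsto_pow_atTop_nhds_zero_of_lt_one (by norm_num) (by norm_num)
  have h3 : Tendsto (fun s : ℕ => (s : ℝ) ^ 2 / (9 / 8 : ℝ) ^ s) atTop (nhds 0) :=
    tendsto_pow_const_div_const_pow_of_one_lt 2 (by norm_num)
  filter_upwards [eventually_ge_atTop 24,
    h1.eventually (eventually_le_nhds (show (0 : ℝ) < 1 / 1024 by norm_num)),
    h2.eventually (eventually_le_nhds (show (0 : ℝ) < 1 / 32 by norm_num)),
    h3.eventually (eventually_le_nhds (show (0 : ℝ) < 1 / 32 by norm_num))] with s hs e1 e2 e3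
  refine ⟨hs, ?_, ?_⟩
  · have e4 : (0 : ℝ) < 4 ^ s := by positivity
    -- The margin of the method: (9/4)(17/10) = 4·153/160 is just below 4.
    have a1 : ((9 : ℝ) / 4) ^ s * (17 / 10) ^ s = 4 ^ s * (153 / 160) ^ s := by
      rw [← mul_pow, ← mul_pow]; norm_num
    have a2 : ((17 : ℝ) / 10) ^ s = 4 ^ s * (17 / 40) ^ s := by
      rw [← mul_pow]; norm_num
    calc (32 * s * (9 / 4) ^ s + 1) * (17 / 10 : ℝ) ^ s
        = 32 * s * ((9 / 4) ^ s * (17 / 10 : ℝ) ^ s) + (17 / 10 : ℝ) ^ s := by ring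
      _ = 4 ^ s * (32 * (s * (153 / 160) ^ s) + (17 / 40) ^ s) := by rw [a1, a2]; ring
      _ ≤ 4 ^ s * (1 / 16) := by gcongr; linarith
      _ = _ := by ring
  · rw [div_le_iff₀ (by positivity)] at e3
    linarith

lemma two_pow_le (s : ℕ) : (2 : ℝ) ^ (3 * s / 4) ≤ (17 / 10) ^ s := by
  refine le_of_pow_le_pow_left₀ (n := 4) (by norm_num) (by positivity) ?_
  calc ((2 : ℝ) ^ (3 * s / 4)) ^ 4 = 2 ^ (3 * s / 4 * 4) := by rw [← pow_mul]
    _ ≤ 2 ^ (3 * s) := pow_le_pow_right₀ (by norm_num) (by omega)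
    _ = (2 ^ 3) ^ s := by rw [pow_mul]
    _ ≤ ((17 / 10) ^ 4) ^ s := by gcongr; norm_num
    _ = _ := by rw [← pow_mul, ← pow_mul, mul_comm]

/-- A bound for the number of selected completions of a short interval. -/
noncomputable def completionBound (s : ℕ) : ℕ := ⌈(32 * s * (9 / 4) ^ s : ℝ)⌉₊

/-- Makes the tail 2^(-J) at J = `completionBound s` at most 4^(-(k+1)), as k + 1 ≤ s². -/
lemma le_completionBound {s : ℕ} : 2 * (s * s) ≤ completionBound s := by
  have h1 : (s : ℝ) ≤ (9 / 4) ^ s := by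
    have := one_add_mul_le_pow (show (-2 : ℝ) ≤ 5 / 4 by norm_num) s
    have h0 : (0 : ℝ) ≤ s := by positivity
    norm_num at this
    linarith
  have h2 : (2 * (s * s) : ℝ) ≤ completionBound s := by
    refine le_trans ?_ (Nat.le_ceil _)
    have h0 : (0 : ℝ) ≤ s := by positivity
    nlinarith [mul_le_mul_of_nonneg_left h1 h0]
  exact_mod_cast h2

namespace IsShortInterval

variable {k s X : ℕ} (h : IsShortInterval k s X)
include h

lemma succ_le_sq : k + 1 ≤ s * s := by
  rw [h.level_eq]
  exact Nat.lt_succ_sqrt k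

/-- The mean number of selected completions is at most 4s(9/4)^s, an eighth of the threshold. -/
lemma selectionLaw_completions_le {k₀ : ℕ} {A : Finset ℕ}
    (hA : A ⊆ admissible k₀ (range X)) :
    selectionLaw {ω | IsThin A ∧ completionBound s ≤ (completions A
      (trace (admissible k₀ (Ico (X + 4 ^ s) (4 ^ (k + 1)))) ω) (Ico X (X + 4 ^ s))).card} ≤
      (((1 / 4) ^ (k + 1) : ℝ≥0) : ℝ≥0∞) := by
  classical
  by_cases hthin : IsThin A
  swap
  · simp [hthin]
  set S := admissible k₀ (Ico (X + 4 ^ s) (4 ^ (k + 1))) with hS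
  set I := Ico X (X + 4 ^ s) with hI
  have hsub : {ω | IsThin A ∧ completionBound s ≤ (completions A (trace S ω) I).card} ⊆
      {ω | completionBound s ≤ (trace (completions A S I) ω).card} := by
    rintro ω ⟨_, hω⟩
    refine hω.trans (card_le_card fun c hc => ?_)
    simp only [completions, trace, mem_filter] at hc ⊢
    exact ⟨⟨hc.1.1, hc.2⟩, hc.1.2⟩
  refine (measure_mono hsub).trans ((randomSet_card_le (q := (9 / 32) ^ s) ?_ _).trans ?_)
  · intro c hc
    have hc' := mem_Ico.1 (mem_filter.1 (mem_filter.1 hc).1).1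
    refine density_le ?_
    rw [← h.level_of_mem (mem_Ico.2 ⟨le_rfl, Nat.lt_add_of_pos_right (by positivity)⟩)]
    exact level_mono ((Nat.le_add_right _ _).trans hc'.1)
  · have hN := h.card_completions_le hA hthin (S := S) subset_rfl
    have h1 : (((completions A S I).card : ℕ) : ℝ) * (((9 / 32) ^ s : ℝ≥0) : ℝ) ≤
        (completionBound s : ℝ) / 8 := by
      have hN' : ((completions A S I).card : ℝ) ≤ 4 ^ s * (2 ^ s * (4 * s)) := by
        exact_mod_cast hN
      push_cast
      calc ((completions A S I).card : ℝ) * (9 / 32) ^ s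
          ≤ 4 ^ s * (2 ^ s * (4 * s)) * (9 / 32) ^ s := by gcongr
        _ = 4 * s * (4 * 2 * (9 / 32)) ^ s := by rw [mul_pow, mul_pow]; ring
        _ = (32 * s * (9 / 4) ^ s) / 8 := by norm_num; ring
        _ ≤ _ := by gcongr; exact Nat.le_ceil _
    have h2 : (((completions A S I).card.choose (completionBound s) : ℕ) : ℝ≥0) *
        ((9 / 32) ^ s) ^ (completionBound s) ≤ (1 / 4) ^ (k + 1) := by
      refine (choose_mul_pow_le h1).trans ?_
      have h3 : 2 * (k + 1) ≤ completionBound s :=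
        (Nat.mul_le_mul_left 2 h.succ_le_sq).trans le_completionBound
      calc ((1 : ℝ≥0) / 2) ^ completionBound s ≤ (1 / 2) ^ (2 * (k + 1)) :=
            pow_le_pow_of_le_one (by positivity)
              (by rw [← NNReal.coe_le_coe]; push_cast; norm_num) h3
        _ = _ := by rw [pow_mul, div_pow]; norm_num
    exact_mod_cast h2

/-- For fixed `A`, at least 4^s/8 - 4^s/16 sieved points are not middle terms, and all of them must
go unselected. -/
lemma selectionLaw_all_middle_le {k₀ : ℕ} (hk : 4 ^ k₀ ≤ X) (hs : IsLarge s) (A : Finset ℕ) :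
    selectionLaw {ω | open Classical in
      ((Ico X (X + 4 ^ s)).filter (IsMiddle A)).card ≤ completionBound s * 2 ^ (3 * s / 4) ∧
      ∀ b ∈ trace (admissible k₀ (Ico X (X + 4 ^ s))) ω, IsMiddle A b} ≤
      (((1 / 4) ^ (k + 1) : ℝ≥0) : ℝ≥0∞) := by
  classical
  set I := Ico X (X + 4 ^ s) with hI
  by_cases hcard : (I.filter (IsMiddle A)).card ≤ completionBound s * 2 ^ (3 * s / 4)
  swap
  · refine le_trans (measure_mono (t := ∅) ?_) (by simp)
    rintro ω ⟨h1, _⟩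
    exact hcard (by convert h1)
  set S := admissible k₀ I with hS
  set G := S.filter fun b => ¬ IsMiddle A b with hG
  have hsub : {ω | ((Ico X (X + 4 ^ s)).filter (IsMiddle A)).card ≤
      completionBound s * 2 ^ (3 * s / 4) ∧ ∀ b ∈ trace S ω, IsMiddle A b} ⊆
      {ω | Disjoint (trace S ω) G} := by
    rintro ω ⟨_, hω⟩
    exact Finset.disjoint_left.2 fun b hb hbG => (mem_filter.1 hbG).2 (hω b hb)
  have hlev : ∀ n ∈ I, level n = s := fun n hn => h.level_of_mem hn
  have hSI : S = I.filter IsSieved := by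
    ext n
    simp only [hS, admissible, mem_filter, IsAdmissible, and_congr_right_iff, and_iff_right_iff_imp]
    intro hn _
    exact hk.trans (mem_Ico.1 hn).1
  have hScard := card_sieved_ge (X := X) (s := s) (by have := hs.ge; omega) hlev
  rw [← hI, ← hSI] at hScard
  have hGcard : (4 : ℝ) ^ s / 16 ≤ G.card := by
    have h1 := Finset.card_filter_add_card_filter_not (s := S) (IsMiddle A)
    have h2 : (S.filter (IsMiddle A)).card ≤ (I.filter (IsMiddle A)).card :=
      card_le_card (filter_subset_filter _ (filter_subset _ _))
    have h3 : (S.card : ℝ) ≤ completionBound s * 2 ^ (3 * s / 4) + G.card := by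
      have : S.card ≤ completionBound s * 2 ^ (3 * s / 4) + G.card := by
        rw [← h1, hG]; omega
      exact_mod_cast this
    have h4 : (completionBound s : ℝ) * 2 ^ (3 * s / 4) ≤ 4 ^ s / 16 := by
      refine le_trans ?_ hs.killed
      gcongr
      · exact (Nat.ceil_lt_add_one (by positivity)).le
      · exact two_pow_le s
    linarith
  refine (measure_mono (by convert hsub)).trans ?_
  rw [selectionLaw, randomSet_disjoint (filter_subset _ _) (q := (9 / 32) ^ s) fun n hn => by
    rw [density, hlev n (mem_filter.1 (mem_filter.1 hn).1).1]]
  have hq : ((9 / 32) ^ s : ℝ≥0) ≤ 1 := pow_le_one₀ (by positivity) (by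
    rw [← NNReal.coe_le_coe]; push_cast; norm_num)
  have : (1 - (9 / 32) ^ s : ℝ≥0) ^ G.card ≤ (1 / 4) ^ (k + 1) := by
    rw [← NNReal.coe_le_coe]
    push_cast [NNReal.coe_sub hq]
    calc (1 - (9 / 32 : ℝ) ^ s) ^ G.card ≤ Real.exp (-(9 / 32 : ℝ) ^ s) ^ G.card := by
          have h1 := Real.add_one_le_exp (-(9 / 32 : ℝ) ^ s)
          have h2 : (9 / 32 : ℝ) ^ s ≤ 1 := pow_le_one₀ (by norm_num) (by norm_num)
          gcongr
          linarith
      _ = Real.exp (-((9 / 32 : ℝ) ^ s * G.card)) := by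
          rw [← Real.exp_nat_mul]; congr 1; ring
      _ ≤ Real.exp (-(2 * (k + 1 : ℕ))) := by
          refine Real.exp_le_exp.2 (neg_le_neg ?_)
          calc (2 * (k + 1 : ℕ) : ℝ) ≤ 2 * s ^ 2 := by
                have := h.succ_le_sq
                gcongr
                rw [sq]
                exact_mod_cast this
            _ ≤ (9 / 8) ^ s / 16 := hs.growth
            _ = (9 / 32) ^ s * (4 ^ s / 16) := by
                rw [← mul_div_assoc, ← mul_pow]; norm_num
            _ ≤ (9 / 32) ^ s * G.card := by gcongr
      _ = (Real.exp (-2)) ^ (k + 1) := by rw [← Real.exp_nat_mul]; congr 1; push_cast; ring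
      _ ≤ (1 / 4) ^ (k + 1) := by
          gcongr
          rw [Real.exp_neg, ← one_div]
          gcongr
          have : Real.exp 2 = Real.exp 1 ^ 2 := by rw [← Real.exp_nat_mul]; norm_num
          rw [this]
          nlinarith [Real.exp_one_gt_d9]
  exact_mod_cast this

end IsShortInterval

end GeometricProgressionFree

/-! ### Union bound over all intervals. -/

namespace GeometricProgressionFree

open Finset MeasureTheory Filter
open scoped NNReal ENNReal

/-- Two exposures: fix the selection below the interval and randomise above it to bound the
completions; then fix everything outside and randomise inside. -/
lemma IsShortInterval.selectionLaw_no_survivor_le {k s X k₀ : ℕ} (h : IsShortInterval k s X)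
    (hk : 4 ^ k₀ ≤ X) (hs : IsLarge s) :
    selectionLaw {ω | IsThin (selected k₀ ω) ∧
      ∀ b ∈ Ico X (X + 4 ^ s), b ∈ selected k₀ ω → IsMiddle (selected k₀ ω) b} ≤
      ((2 * (1 / 4) ^ (k + 1) : ℝ≥0) : ℝ≥0∞) := by
  classical
  set I := Ico X (X + 4 ^ s) with hI
  set lo := admissible k₀ (range X) with hlo
  set hi := admissible k₀ (Ico (X + 4 ^ s) (4 ^ (k + 1))) with hhi
  set mid := admissible k₀ I with hmid
  have hsel : ∀ (S : Finset ℕ) ω n, n ∈ trace (admissible k₀ S) ω → n ∈ selected k₀ ω :=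
    fun S ω n hn => ⟨(mem_filter.1 (mem_filter.1 hn).1).2, (mem_filter.1 hn).2⟩
  have hsel' : ∀ (S : Finset ℕ) ω n, n ∈ S → n ∈ selected k₀ ω → n ∈ trace (admissible k₀ S) ω :=
    fun S ω n hn hnω => mem_filter.2 ⟨mem_filter.2 ⟨hn, hnω.1⟩, hnω.2⟩
  have hsub : {ω | IsThin (selected k₀ ω) ∧
      ∀ b ∈ I, b ∈ selected k₀ ω → IsMiddle (selected k₀ ω) b} ⊆
      {ω | IsThin (trace lo ω) ∧
        completionBound s ≤ (completions (trace lo ω) (trace hi ω) I).card} ∪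
      {ω | (I.filter (IsMiddle (trace (lo ∪ hi) ω))).card ≤ completionBound s * 2 ^ (3 * s / 4) ∧
        ∀ b ∈ trace mid ω, IsMiddle (trace (lo ∪ hi) ω) b} := by
    rintro ω ⟨hthin, hω⟩
    have hthin' : IsThin (trace lo ω) := fun d =>
      (card_le_card (roughShifts_mono (fun n hn => hsel _ ω n hn) d)).trans_lt (hthin d)
    by_cases hJ : completionBound s ≤ (completions (trace lo ω) (trace hi ω) I).card
    · exact Or.inl ⟨hthin', hJ⟩
    refine Or.inr ⟨?_, fun b hb => ?_⟩
    · have : trace (lo ∪ hi) ω = trace lo ω ∪ trace hi ω := filter_union _ _ _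
      rw [this]
      refine le_trans ?_ (Nat.mul_le_mul_right _ (le_of_not_ge hJ))
      convert h.card_middle_le hs.ge (trace_subset lo ω) (trace_subset hi ω)
    · have hbI : b ∈ I := (mem_filter.1 (mem_filter.1 hb).1).1
      obtain ⟨m, hm, c, hc, hmb, hmc⟩ := hω b hbI (hsel _ ω b hb)
      obtain ⟨h1, h2, h3⟩ := h.outer_not_mem hbI
        (lt_of_lt_of_le (by positivity) hm.1.1) hmb hmc
      have hm' := hsel' _ ω m (mem_range.2 h1) hm
      have hc' := hsel' _ ω c (mem_Ico.2 ⟨h2, h3⟩) hc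
      refine ⟨m, ?_, c, ?_, hmb, hmc⟩
      · exact mem_filter.2 ⟨mem_union_left _ (mem_filter.1 hm').1, (mem_filter.1 hm').2⟩
      · exact mem_filter.2 ⟨mem_union_right _ (mem_filter.1 hc').1, (mem_filter.1 hc').2⟩
  have hdisj : Disjoint lo hi := Finset.disjoint_left.2 fun n hn hn' => by
    have h1 := mem_range.1 (mem_filter.1 hn).1
    have h2 := (mem_Ico.1 (mem_filter.1 hn').1).1
    exact absurd (h1.trans_le ((Nat.le_add_right _ _).trans h2)) (lt_irrefl _)
  have hdisj' : Disjoint (lo ∪ hi) mid := Finset.disjoint_left.2 fun n hn hn' => by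
    have h3 := mem_Ico.1 (mem_filter.1 hn').1
    rcases mem_union.1 hn with hn | hn
    · have h1 := mem_range.1 (mem_filter.1 hn).1
      omega
    · have h2 := (mem_Ico.1 (mem_filter.1 hn).1).1
      omega
  refine (measure_mono hsub).trans ((measure_union_le _ _).trans ?_)
  have e1 := randomSet_le_of_forall_trace (p := density) (hp := density_le_one) hdisj
    (fun A C => IsThin A ∧ completionBound s ≤ (completions A C I).card)
    fun A hA => h.selectionLaw_completions_le hA
  have e2 := randomSet_le_of_forall_trace (p := density) (hp := density_le_one) hdisj'
    (fun A B => (I.filter (IsMiddle A)).card ≤ completionBound s * 2 ^ (3 * s / 4) ∧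
      ∀ b ∈ B, IsMiddle A b) (ε := (((1 / 4) ^ (k + 1) : ℝ≥0) : ℝ≥0∞))
    fun A _ => by
      convert h.selectionLaw_all_middle_le hk hs A
      rfl
  refine (add_le_add e1 e2).trans (le_of_eq ?_)
  rw [two_mul, ENNReal.coe_add]

lemma four_mul_le_of_isLarge {k : ℕ} (hs : IsLarge (Nat.sqrt k + 1)) :
    4 * (Nat.sqrt k + 1) ≤ k := by
  have h1 := hs.ge
  have h2 := Nat.sqrt_le k
  nlinarith

lemma isShortInterval {k j : ℕ} (hs : IsLarge (Nat.sqrt k + 1))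
    (hj : (j + 1) * 4 ^ (Nat.sqrt k + 1) ≤ 2 ^ k) :
    IsShortInterval k (Nat.sqrt k + 1) (2 ^ k + j * 4 ^ (Nat.sqrt k + 1)) where
  level_eq := rfl
  four_mul_le := four_mul_le_of_isLarge hs
  lower := Nat.le_add_right _ _
  upper := by
    rw [pow_succ 2 k]
    linarith

lemma selectionLaw_block_le {k k₀ : ℕ} (hk : 2 * k₀ ≤ k) (hs : IsLarge (Nat.sqrt k + 1)) :
    selectionLaw {ω | IsThin (selected k₀ ω) ∧
      ∃ j, (j + 1) * 4 ^ (Nat.sqrt k + 1) ≤ 2 ^ k ∧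
        ∀ b ∈ Ico (2 ^ k + j * 4 ^ (Nat.sqrt k + 1))
          (2 ^ k + j * 4 ^ (Nat.sqrt k + 1) + 4 ^ (Nat.sqrt k + 1)),
        b ∈ selected k₀ ω → IsMiddle (selected k₀ ω) b} ≤
      (((1 / 2) ^ (k + 1) : ℝ≥0) : ℝ≥0∞) := by
  set s := Nat.sqrt k + 1 with hs'
  have hsub : {ω | IsThin (selected k₀ ω) ∧ ∃ j, (j + 1) * 4 ^ s ≤ 2 ^ k ∧
      ∀ b ∈ Ico (2 ^ k + j * 4 ^ s) (2 ^ k + j * 4 ^ s + 4 ^ s),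
        b ∈ selected k₀ ω → IsMiddle (selected k₀ ω) b} ⊆
      ⋃ j ∈ (range (2 ^ k)).filter (fun j => (j + 1) * 4 ^ s ≤ 2 ^ k),
        {ω | IsThin (selected k₀ ω) ∧
          ∀ b ∈ Ico (2 ^ k + j * 4 ^ s) (2 ^ k + j * 4 ^ s + 4 ^ s),
            b ∈ selected k₀ ω → IsMiddle (selected k₀ ω) b} := by
    rintro ω ⟨hthin, j, hj, hω⟩
    simp only [Set.mem_iUnion, mem_filter, mem_range]
    exact ⟨j, ⟨(Nat.le_mul_of_pos_right _ (by positivity)).trans hj, hj⟩, hthin, hω⟩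
  refine (measure_mono hsub).trans ((measure_biUnion_finset_le _ _).trans ?_)
  refine (Finset.sum_le_card_nsmul _ _ ((2 * (1 / 4) ^ (k + 1) : ℝ≥0) : ℝ≥0∞) fun j hj => ?_).trans
    ?_
  · refine (isShortInterval hs (mem_filter.1 hj).2).selectionLaw_no_survivor_le ?_ hs
    calc 4 ^ k₀ = 2 ^ (2 * k₀) := by rw [pow_mul]; norm_num
      _ ≤ 2 ^ k := Nat.pow_le_pow_right two_pos hk
      _ ≤ _ := Nat.le_add_right _ _
  · rw [nsmul_eq_mul]
    have hc : ((range (2 ^ k)).filter (fun j => (j + 1) * 4 ^ s ≤ 2 ^ k)).card ≤ 2 ^ k :=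
      (card_filter_le _ _).trans (by simp)
    have : ((((range (2 ^ k)).filter (fun j => (j + 1) * 4 ^ s ≤ 2 ^ k)).card : ℕ) : ℝ≥0) *
        (2 * (1 / 4) ^ (k + 1)) ≤ (1 / 2) ^ (k + 1) := by
      calc _ ≤ (2 : ℝ≥0) ^ k * (2 * (1 / 4) ^ (k + 1)) := by
            gcongr
            exact_mod_cast hc
        _ = (2 * (1 / 4)) ^ (k + 1) := by rw [mul_pow, pow_succ]; ring
        _ = (1 / 2) ^ (k + 1) := by
            congr 1
            rw [← NNReal.coe_inj]; push_cast; norm_num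
    exact_mod_cast this

lemma isThin_selected {k₀ : ℕ} {ω : ℕ → Bool}
    (h : ∀ d, 2 ^ k₀ ≤ d → (roughShifts {n | ω n = true} d).card < 4 * level d) :
    IsThin (selected k₀ ω) := by
  intro d
  by_cases hd : 2 ^ k₀ ≤ d
  · exact (card_le_card (roughShifts_mono (fun n hn => hn.2) d)).trans_lt (h d hd)
  -- For small d, every shift has d x ≤ d² < 4^k₀, below all selected integers.
  · have : roughShifts (selected k₀ ω) d = ∅ := by
      refine Finset.eq_empty_of_forall_notMem fun x hx => hd ?_
      obtain ⟨h1, _, h2⟩ := mem_roughShifts.1 hx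
      have h3 : 2 ^ k₀ * 2 ^ k₀ ≤ d * d := by
        calc 2 ^ k₀ * 2 ^ k₀ = 4 ^ k₀ := by rw [← mul_pow]; norm_num
          _ ≤ d * x := h2.1.1
          _ ≤ d * d := Nat.mul_le_mul_left _ (Nat.divisor_le h1)
      exact Nat.mul_self_le_mul_self_iff.1 h3
    rw [this]
    have := level_pos d
    simpa using this

lemma eventually_isLarge_sqrt : ∀ᶠ k in atTop, IsLarge (Nat.sqrt k + 1) := by
  have : Tendsto (fun k => Nat.sqrt k + 1) atTop atTop := by
    refine tendsto_atTop_mono (fun k => Nat.le_succ _) (tendsto_atTop.2 fun b => ?_)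
    filter_upwards [eventually_ge_atTop (b * b)] with k hk
    exact Nat.le_sqrt.2 hk
  exact this.eventually eventually_isLarge

/-- Sets without three-term geometric progressions that meet all short intervals. -/
theorem exists_progressionFree_set : ∀ᶠ k₀ : ℕ in atTop, ∃ T : Set ℕ,
    (∀ n ∈ T, 4 ^ k₀ ≤ n) ∧ (∀ b ∈ T, ¬ IsMiddle T b) ∧
    ∀ k, 2 * k₀ ≤ k → 4 * (Nat.sqrt k + 1) ≤ k ∧
      ∀ j, (j + 1) * 4 ^ (Nat.sqrt k + 1) ≤ 2 ^ k →
      ∃ b ∈ T, 2 ^ k + j * 4 ^ (Nat.sqrt k + 1) ≤ b ∧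
        b < 2 ^ k + (j + 1) * 4 ^ (Nat.sqrt k + 1) := by
  filter_upwards [eventually_forall_ge_atTop.2 eventually_isLarge_sqrt, eventually_ge_atTop 2] with k₀ hlarge hk₀
  set E : ℕ → Set (ℕ → Bool) := fun l => {ω | ∃ d ∈ Ico (2 ^ l) (2 ^ (l + 1)),
      4 * level d ≤ (roughShifts {n | ω n = true} d).card}
  set F : ℕ → Set (ℕ → Bool) := fun k => {ω | 2 * k₀ ≤ k ∧ IsThin (selected k₀ ω) ∧
      ∃ j, (j + 1) * 4 ^ (Nat.sqrt k + 1) ≤ 2 ^ k ∧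
        ∀ b ∈ Ico (2 ^ k + j * 4 ^ (Nat.sqrt k + 1))
          (2 ^ k + j * 4 ^ (Nat.sqrt k + 1) + 4 ^ (Nat.sqrt k + 1)),
        b ∈ selected k₀ ω → IsMiddle (selected k₀ ω) b}
  have hbound : ∀ i, selectionLaw (E (k₀ + i) ∪ F (k₀ + i)) ≤ (1 / 4) * (1 / 2) ^ i := by
    intro i
    have h1 : selectionLaw (E (k₀ + i)) ≤ (((1 / 4) ^ (k₀ + i + 1) : ℝ≥0) : ℝ≥0∞) :=
      selectionLaw_block_shifts_le _
    have h2 : selectionLaw (F (k₀ + i)) ≤ (((1 / 2) ^ (k₀ + i + 1) : ℝ≥0) : ℝ≥0∞) := by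
      by_cases hi : 2 * k₀ ≤ k₀ + i
      · refine le_trans (measure_mono ?_)
          (selectionLaw_block_le hi (hlarge _ (Nat.le_add_right _ _)))
        exact fun ω hω => hω.2
      · refine le_trans (measure_mono (t := ∅) ?_) (by simp)
        exact fun ω hω => hi hω.1
    refine (measure_union_le _ _).trans ((add_le_add h1 h2).trans ?_)
    have h3 : ((1 / 4) ^ (k₀ + i + 1) + (1 / 2) ^ (k₀ + i + 1) : ℝ≥0) ≤ (1 / 4) * (1 / 2) ^ i := by
      rw [← NNReal.coe_le_coe]
      push_cast
      have h4 : ((1 : ℝ) / 4) ^ (k₀ + i + 1) ≤ (1 / 2) ^ (k₀ + i + 1) := by gcongr; norm_num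
      -- This uses k₀ ≥ 2; the resulting total failure probability is at most 1/2.
      have h5 : ((1 : ℝ) / 2) ^ (k₀ + i + 1) ≤ (1 / 2) ^ (i + 3) :=
        pow_le_pow_of_le_one (by norm_num) (by norm_num) (by omega)
      have h6 : ((1 : ℝ) / 2) ^ (i + 3) = 1 / 8 * (1 / 2) ^ i := by rw [pow_add]; ring
      linarith
    rw [← ENNReal.coe_add]
    refine (ENNReal.coe_le_coe.2 h3).trans (le_of_eq ?_)
    simp [ENNReal.inv_pow]
  have hlt : selectionLaw (⋃ i, (E (k₀ + i) ∪ F (k₀ + i))) < 1 := by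
    refine (measure_iUnion_le _).trans_lt ((ENNReal.tsum_le_tsum hbound).trans_lt ?_)
    rw [ENNReal.tsum_mul_left, one_div 2, ENNReal.tsum_geometric, ENNReal.one_sub_inv_two, inv_inv]
    have : ((1 / 4 : ℝ≥0∞)) * 2 = (((1 / 2 : ℝ≥0)) : ℝ≥0∞) := by
      have h7 : (1 / 2 : ℝ≥0) = (1 / 4) * 2 := by rw [← NNReal.coe_inj]; push_cast; norm_num
      rw [h7]
      simp
    rw [this]
    exact_mod_cast (show (1 / 2 : ℝ≥0) < 1 by rw [← NNReal.coe_lt_coe]; push_cast; norm_num)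
  obtain ⟨ω, hω⟩ : ∃ ω, ω ∉ ⋃ i, (E (k₀ + i) ∪ F (k₀ + i)) := by
    by_contra! hall
    rw [Set.eq_univ_of_forall hall, measure_univ] at hlt
    exact lt_irrefl _ hlt
  simp only [Set.mem_iUnion, not_exists, Set.mem_union, not_or] at hω
  have hthin : IsThin (selected k₀ ω) := by
    refine isThin_selected fun d hd => ?_
    by_contra! hc
    have hd0 : d ≠ 0 := (lt_of_lt_of_le (by positivity) hd).ne'
    have h1 : k₀ ≤ Nat.log 2 d := Nat.le_log_of_pow_le one_lt_two hd
    obtain ⟨i, hi⟩ := Nat.exists_eq_add_of_le h1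
    refine (hω i).1 ⟨d, ?_, hc⟩
    rw [← hi, mem_Ico]
    exact ⟨Nat.pow_log_le_self 2 hd0, Nat.lt_pow_succ_log_self one_lt_two d⟩
  refine ⟨{b | b ∈ selected k₀ ω ∧ ¬ IsMiddle (selected k₀ ω) b}, fun n hn => hn.1.1.1, ?_, ?_⟩
  · rintro b hb ⟨m, hm, c, hc, h⟩
    exact hb.2 ⟨m, hm.1, c, hc.1, h⟩
  · intro k hk
    refine ⟨four_mul_le_of_isLarge (hlarge k (by omega)), fun j hj => ?_⟩
    obtain ⟨i, rfl⟩ := Nat.exists_eq_add_of_le (show k₀ ≤ k by omega)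
    by_contra! hc
    refine (hω i).2 ⟨hk, hthin, j, hj, fun b hb hbs => ?_⟩
    by_contra hbm
    have h1 := mem_Ico.1 hb
    have h2 := hc b ⟨hbs, hbm⟩ h1.1
    rw [Nat.succ_mul] at h2
    omega

/-! ### From short intervals to gaps. -/

/-- If `T` meets all the short intervals, then its gaps are short. -/
lemma gap_le {k₀ : ℕ} {T : Set ℕ} (h0 : ∀ n ∈ T, 4 ^ k₀ ≤ n)
    (hT : ∀ k, 2 * k₀ ≤ k → 4 * (Nat.sqrt k + 1) ≤ k ∧
      ∀ j, (j + 1) * 4 ^ (Nat.sqrt k + 1) ≤ 2 ^ k →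
      ∃ b ∈ T, 2 ^ k + j * 4 ^ (Nat.sqrt k + 1) ≤ b ∧
        b < 2 ^ k + (j + 1) * 4 ^ (Nat.sqrt k + 1))
    {N x : ℕ} (hN : N ∈ T) (hx : x ∈ T) (hbetween : ∀ b ∈ T, N < b → ¬ b < x) :
    x ≤ N + 2 * 4 ^ (Nat.sqrt (Nat.log 2 x) + 1) := by
  by_contra! hlt
  set k := Nat.log 2 x with hk
  set H := 4 ^ (Nat.sqrt k + 1) with hH
  have hHpos : 0 < H := by positivity
  have hx0 : x ≠ 0 := by omega
  have hkx : 2 ^ k ≤ x := Nat.pow_log_le_self 2 hx0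
  have hxk : x < 2 ^ (k + 1) := Nat.lt_pow_succ_log_self one_lt_two x
  have hkk : 2 * k₀ ≤ k := by
    refine Nat.le_log_of_pow_le one_lt_two ?_
    rw [pow_mul]
    exact h0 x hx
  have hdiv := Nat.div_add_mod (x - 2 ^ k) H
  have hmod := Nat.mod_lt (x - 2 ^ k) hHpos
  rcases hj : (x - 2 ^ k) / H with _ | j
  -- Here x lies in the first cell of its block, so the last cell of the previous block is used; N ≥
  -- 4^k₀ ensures that this block is covered.
  · rw [hj, mul_zero, zero_add] at hdiv
    have hN2 : N < 2 ^ k := by omega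
    have hklt : 2 * k₀ < k := by
      refine (Nat.pow_lt_pow_iff_right one_lt_two).1 (lt_of_le_of_lt ?_ hN2)
      rw [pow_mul]
      exact h0 N hN
    obtain ⟨l, hl⟩ : ∃ l, k = l + 1 := ⟨k - 1, by omega⟩
    obtain ⟨h4, hmeet⟩ := hT l (by omega)
    set H' := 4 ^ (Nat.sqrt l + 1) with hH'
    have hH'pos : 0 < H' := by positivity
    have hHH : H' ≤ H := Nat.pow_le_pow_right (by norm_num)
      (Nat.add_le_add_right (Nat.sqrt_le_sqrt (by omega)) 1)
    -- The cell length is a power of two dividing 2^l, so the last cell ends exactly at 2^k.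
    obtain ⟨q, hq⟩ : ∃ q, 2 ^ l = (q + 1) * H' := by
      have : H' ∣ 2 ^ l := by
        rw [hH', show 4 = 2 ^ 2 by norm_num, ← pow_mul]
        exact pow_dvd_pow 2 (by omega)
      obtain ⟨c, hc⟩ := this
      have hc0 : c ≠ 0 := by
        rintro rfl
        have : 0 < 2 ^ l := by positivity
        omega
      exact ⟨c - 1, by rw [hc, Nat.sub_add_cancel (Nat.pos_of_ne_zero hc0), mul_comm]⟩
    obtain ⟨b, hb, hb1, hb2⟩ := hmeet q hq.ge
    have h5 : 2 ^ k = 2 ^ l + (q + 1) * H' := by rw [hl, pow_succ, ← hq]; ring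
    rw [Nat.succ_mul] at h5 hb2
    exact hbetween b hb (by omega) (by omega)
  -- Otherwise cell `j`, just before the one of x, lies entirely below x.
  · rw [hj] at hdiv
    have hpow : 2 ^ (k + 1) = 2 ^ k + 2 ^ k := by ring
    have hmeet := (hT k hkk).2 j
    rw [← hH] at hmeet
    obtain ⟨b, hb, hb1, hb2⟩ := hmeet (by rw [mul_comm]; omega)
    have h6 : H * (j + 1) = j * H + H := by ring
    rw [Nat.succ_mul] at hb2
    exact hbetween b hb (by omega) (by omega)

/-- With L = √(log 2 log x) ≥ ⌊√k⌋ log 2, the left side is exp((2⌊√k⌋ + 3) log 2), and log log x ≥ 3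
already makes the radicand at least (L + (3/2) log 2)². -/
lemma gapRadicand_bound {ε x : ℝ} {k : ℕ} (hε : 0 < ε) (hk : (2 : ℝ) ^ k ≤ x)
    (hx : 3 ≤ Real.log (Real.log x)) (hx1 : 1 ≤ x) :
    0 ≤ gapRadicand ε x ∧
      2 * (4 : ℝ) ^ (Nat.sqrt k + 1) ≤ Real.exp (2 * Real.sqrt (gapRadicand ε x)) := by
  have hlogx : 0 ≤ Real.log x := Real.log_nonneg hx1
  have hlog2 : 0 < Real.log 2 := Real.log_pos (by norm_num)
  have hl1 := Real.log_two_gt_d9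
  have hl2 := Real.log_two_lt_d9
  have hlogx4 : 4 ≤ Real.log x := by
    have h1 := Real.log_le_sub_one_of_pos (show 0 < Real.log x by
      rcases hlogx.lt_or_eq with h | h
      · exact h
      · rw [← h, Real.log_zero] at hx; linarith)
    linarith
  set P := Real.log 2 * Real.log x with hP
  have hPnn : 0 ≤ P := by positivity
  set L := Real.sqrt P with hL
  have hLsq : L ^ 2 = P := Real.sq_sqrt hPnn
  have hL1 : 1 ≤ L := by
    rw [hL, Real.one_le_sqrt]
    nlinarith
  have hrad : (L + 3 / 2 * Real.log 2) ^ 2 ≤ gapRadicand ε x := by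
    have h1 : gapRadicand ε x = L ^ 2 + (3 + ε) / 2 * L * Real.log (Real.log x) := by
      rw [hLsq]; rfl
    have h2 : 3 / 2 * L * 3 ≤ (3 + ε) / 2 * L * Real.log (Real.log x) := by
      gcongr
      linarith
    rw [h1]
    nlinarith
  have hradnn : 0 ≤ gapRadicand ε x := (sq_nonneg _).trans hrad
  refine ⟨hradnn, ?_⟩
  have h3 : L + 3 / 2 * Real.log 2 ≤ Real.sqrt (gapRadicand ε x) := Real.le_sqrt_of_sq_le hrad
  have hsqrt : (Nat.sqrt k : ℝ) * Real.log 2 ≤ L := by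
    refine Real.le_sqrt_of_sq_le ?_
    have h4 : (Nat.sqrt k : ℝ) ^ 2 ≤ k := by
      rw [sq]
      exact_mod_cast Nat.sqrt_le k
    have h5 : k * Real.log 2 ≤ Real.log x := by
      rw [← Real.log_pow]
      exact Real.log_le_log (by positivity) hk
    calc ((Nat.sqrt k : ℝ) * Real.log 2) ^ 2 = (Nat.sqrt k : ℝ) ^ 2 * Real.log 2 * Real.log 2 := by
          ring
      _ ≤ k * Real.log 2 * Real.log 2 := by gcongr
      _ ≤ Real.log x * Real.log 2 := by gcongr
      _ = P := mul_comm _ _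
  have h6 : 2 * (4 : ℝ) ^ (Nat.sqrt k + 1) = Real.exp ((2 * Nat.sqrt k + 3 : ℕ) * Real.log 2) := by
    rw [Real.exp_nat_mul, Real.exp_log (by norm_num), pow_add 2, pow_mul 2, pow_succ 4]
    norm_num
    ring
  rw [h6]
  refine Real.exp_le_exp.2 ?_
  push_cast
  linarith

lemma avoidsGeometricProgressions_image {T : Set ℕ} (h0 : ∀ n ∈ T, 0 < n) (hT : ∀ b ∈ T, ¬ IsMiddle T b) :
    AvoidsGeometricProgressions 3 ((fun n : ℕ => (n : ℤ)) '' T) := by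
  rintro ⟨r, g, ⟨hr, hg⟩, hmem⟩
  obtain ⟨m, hm, hm'⟩ := hmem 0
  obtain ⟨b, hb, hb'⟩ := hmem 1
  obtain ⟨c, hc, hc'⟩ := hmem 2
  have h1 : (b : ℚ) = r * m := by
    have := hg 0 1 rfl
    rw [← hm', ← hb'] at this
    exact_mod_cast this
  have h2 : (c : ℚ) = r * b := by
    have := hg 1 2 rfl
    rw [← hb', ← hc'] at this
    exact_mod_cast this
  have hmpos : (0 : ℚ) < m := by exact_mod_cast h0 m hm
  refine hT b hb ⟨m, hm, c, hc, ?_, ?_⟩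
  · have : (m : ℚ) < b := by rw [h1]; exact lt_mul_of_one_lt_left hmpos hr
    exact_mod_cast this
  · have : (m : ℚ) * c = b ^ 2 := by
      rw [h2, sq]
      nth_rw 2 [h1]
      ring
    exact_mod_cast this

end GeometricProgressionFree

/-! ### Enumeration of the set. -/

open GeometricProgressionFree Filter in
theorem theorem3 (ε : ℝ) (hε : 0 < ε) :
    ∃ t : ℕ → ℤ,
      StrictMono t ∧
      (∀ n, 0 < t n) ∧
      AvoidsGeometricProgressions 3 (Set.range t) ∧
      ∀ n, 0 ≤ gapRadicand ε (t (n + 1) : ℝ) ∧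
        ((t (n + 1) : ℝ) - (t n : ℝ)) ≤
          Real.exp (2 * Real.sqrt (gapRadicand ε (t (n + 1) : ℝ))) := by
  have hloglog : ∀ᶠ x : ℝ in atTop, 3 ≤ Real.log (Real.log x) :=
    (Real.tendsto_log_atTop.comp Real.tendsto_log_atTop).eventually_ge_atTop 3
  have hpow : Tendsto (fun k : ℕ => (4 : ℝ) ^ k) atTop atTop :=
    tendsto_pow_atTop_atTop_of_one_lt (by norm_num)
  obtain ⟨k₀, ⟨T, h0, hfree, hmeet⟩, hll⟩ :=
    (exists_progressionFree_set.and (hpow.eventually (eventually_forall_ge_atTop.2 hloglog))).exists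
  have hTpos : ∀ n ∈ T, 0 < n := fun n hn => lt_of_lt_of_le (by positivity) (h0 n hn)
  have hinf : (Set.ofPred (· ∈ T)).Infinite := by
    refine Set.infinite_of_not_bddAbove ?_
    rintro ⟨B, hB⟩
    obtain ⟨h4, hj⟩ := hmeet (2 * k₀ + B) (Nat.le_add_right _ _)
    obtain ⟨b, hb, hb1, -⟩ := hj 0 (by
      rw [zero_add, one_mul, show 4 = 2 ^ 2 by norm_num, ← pow_mul]
      exact Nat.pow_le_pow_right two_pos (by omega))
    have h5 : b ≤ B := hB hb
    have h6 : 2 * k₀ + B < 2 ^ (2 * k₀ + B) := Nat.lt_two_pow_self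
    omega
  have hmono := Nat.nth_strictMono hinf
  have hmem : ∀ n, Nat.nth (· ∈ T) n ∈ T := fun n => Nat.nth_mem_of_infinite hinf n
  refine ⟨fun n => (Nat.nth (· ∈ T) n : ℤ), fun a b hab => Nat.cast_lt.2 (hmono hab),
    fun n => Nat.cast_pos.2 (hTpos _ (hmem n)), ?_, fun n => ?_⟩
  · have : Set.range (fun n => (Nat.nth (· ∈ T) n : ℤ)) = (fun n : ℕ => (n : ℤ)) '' T := by
      have h1 : Set.range (Nat.nth (· ∈ T)) = T := Nat.range_nth_of_infinite hinf
      conv_rhs => rw [← h1, ← Set.range_comp]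
      rfl
    rw [this]
    exact avoidsGeometricProgressions_image hTpos hfree
  · set x := Nat.nth (· ∈ T) (n + 1) with hx
    have hxT : x ∈ T := hmem _
    have hxpos := hTpos x hxT
    have hx4 : (4 : ℝ) ^ k₀ ≤ (x : ℝ) := by exact_mod_cast h0 x hxT
    have hgap := gap_le h0 hmeet (hmem n) hxT (fun b hb hnb hbx => by
      classical
      -- An element of `T` strictly between would have an index strictly between n and n + 1.
      rw [← Nat.nth_count (p := (· ∈ T)) hb] at hnb hbx
      have h1 := hmono.lt_iff_lt.1 hnb
      have h2 := hmono.lt_iff_lt.1 hbx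
      omega)
    have hk : (2 : ℝ) ^ Nat.log 2 x ≤ x := by exact_mod_cast Nat.pow_log_le_self 2 hxpos.ne'
    obtain ⟨hr1, hr2⟩ := gapRadicand_bound (ε := ε) hε hk (hll x hx4) (by exact_mod_cast hxpos)
    simp only [Int.cast_natCast]
    refine ⟨hr1, le_trans ?_ hr2⟩
    have : (x : ℝ) ≤ Nat.nth (· ∈ T) n + 2 * 4 ^ (Nat.sqrt (Nat.log 2 x) + 1) := by
      exact_mod_cast hgap
    linarith
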